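/- Let $0<\omega\le 2\pi$ and let $\Omega=\{(r\cos\varphi,r\sin\varphi)\in\mathbb R^2 : 0<r<1,\ 0<\varphi<\omega\}$ be the circular sector of angle $\omega$. For $k\in\mathbb N_0$ put $\nu_k=k\pi/\omega$, let $$J_\nu(z)=\sum_{j=0}^\infty \frac{(-1)^j}{j!\,\Gamma(\nu+j+1)}\Big(\frac z2\Big)^{2j+\nu}$$ be the Bessel function of the first kind, and for an integer $m\ge1$ let $\mu_{\nu_k,m}$ be the $m$-th positive zero of $J_{\nu_k}$ in increasing order. Let $u_{\nu_k,m}$ be the function on $\Omega$ (a Laplace eigenfunction of the sector) given in polar coordinates by $$u_{\nu_k,m}(r,\varphi)=J_{\nu_k}(\mu_{\nu_k,m}\,r)\cos(\nu_k\varphi).$$ For real $s\ge0$ write $s=l+\sigma$ with $l=\lfloor s\rfloor$. If $\sigma=0$, let $H^s(\Omega)$ be the classical Sobolev space of functions in $L^2(\Omega)$ whose weak derivatives of order at most $l$ are in $L^2(\Omega)$. If $0<\sigma<1$, let $H^s(\Omega)$ be the Sobolev–Slobodeckij space of all $u\in H^l(\Omega)$ with $$\int_\Omega\int_\Omega \frac{|D^\alpha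 u(x)-D^\alpha u(y)|^2}{|x-y|^{2+2\sigma}}\,dx\,dy<\infty$$ for every multi-index $\alpha$ of order $l$. Then, for all $k\in\mathbb N_0$ and all integers $m\ge1$: 1. $u_{\nu_k,m}\in H^s(\Omega)$ for all real $s\ge 0$ if and only if $\nu_k=k\pi/\omega\in\mathbb N_0$. 2. If $\nu_k\notin\mathbb N_0$, then $u_{\nu_k,m}\notin H^s(\Omega)$ for every real $s\ge\nu_k+1$; that is, the bound $s<\nu_k+1$ in the regularity result "$u_{\nu_k,m}\in H^s(\Omega)$ for all $0\le s<\nu_k+1$" cannot be relaxed. -/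

import Mathlib

open MeasureTheory

noncomputable section

/-! ### Sobolev and Sobolev–Slobodeckij spaces on an open subset of `ℝᵈ` -/

/-- `g` is the weak partial derivative `∂_{ι 0} ⋯ ∂_{ι (l-1)} u` on the open set `Ω ⊆ ℝᵈ`:
both functions are locally integrable on `Ω`, and
`∫_Ω u · ∂_{ι 0} ⋯ ∂_{ι (l-1)} φ = (-1)^l ∫_Ω g · φ` for all smooth `φ` with compact support in `Ω`.
A multi-index `α` of order `l` is encoded by a list `ι : Fin l → Fin d` of coordinate directions
(the direction `i` occurring `α i` times; the order is immaterial). -/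
def IsWeakPartialDeriv {d l : ℕ} (Ω : Set (EuclideanSpace ℝ (Fin d))) (ι : Fin l → Fin d)
    (u g : EuclideanSpace ℝ (Fin d) → ℝ) : Prop :=
  LocallyIntegrableOn u Ω volume ∧ LocallyIntegrableOn g Ω volume ∧
  ∀ φ : EuclideanSpace ℝ (Fin d) → ℝ, ContDiff ℝ (⊤ : ℕ∞) φ → HasCompactSupport φ →
    tsupport φ ⊆ Ω →
    ∫ x in Ω, u x * iteratedFDeriv ℝ l φ x (fun i => EuclideanSpace.single (ι i) (1 : ℝ))
      = (-1) ^ l * ∫ x in Ω, g x * φ x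

/-- The classical Sobolev space `H^l(Ω)`, `l ∈ ℕ₀`: functions in `L²(Ω)` all of whose weak partial
derivatives of order at most `l` exist and belong to `L²(Ω)`. -/
def MemSobolevNat {d : ℕ} (l : ℕ) (Ω : Set (EuclideanSpace ℝ (Fin d)))
    (u : EuclideanSpace ℝ (Fin d) → ℝ) : Prop :=
  MemLp u 2 (volume.restrict Ω) ∧
  ∀ j ≤ l, ∀ ι : Fin j → Fin d,
    ∃ g : EuclideanSpace ℝ (Fin d) → ℝ,
      IsWeakPartialDeriv Ω ι u g ∧ MemLp g 2 (volume.restrict Ω)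

/-- The square of the Slobodeckij seminorm of order `σ`,
`∫_Ω ∫_Ω |g(x) - g(y)|² / |x - y|^{d + 2σ} dy dx`, with values in `[0, ∞]`. -/
def slobodeckijEnergy {d : ℕ} (σ : ℝ) (Ω : Set (EuclideanSpace ℝ (Fin d)))
    (g : EuclideanSpace ℝ (Fin d) → ℝ) : ENNReal :=
  ∫⁻ x in Ω, ∫⁻ y in Ω, ENNReal.ofReal (|g x - g y| ^ 2 / ‖x - y‖ ^ ((d : ℝ) + 2 * σ))

/-- The space `H^s(Ω)` for real `s ≥ 0`. With `l = ⌊s⌋` and `σ = s - l`, it is the classical Sobolev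
space `H^l(Ω)` if `s` is an integer (`σ = 0`), and otherwise (`0 < σ < 1`) the Sobolev–Slobodeckij
space of all `u ∈ H^l(Ω)` whose weak derivatives of order `l` have finite Slobodeckij seminorm of
order `σ`. -/
def MemSobolevSlobodeckij {d : ℕ} (s : ℝ) (Ω : Set (EuclideanSpace ℝ (Fin d)))
    (u : EuclideanSpace ℝ (Fin d) → ℝ) : Prop :=
  MemSobolevNat ⌊s⌋₊ Ω u ∧
  (s ≠ (⌊s⌋₊ : ℝ) → ∀ ι : Fin ⌊s⌋₊ → Fin d,
    ∃ g : EuclideanSpace ℝ (Fin d) → ℝ,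
      IsWeakPartialDeriv Ω ι u g ∧ MemLp g 2 (volume.restrict Ω) ∧
      slobodeckijEnergy (s - (⌊s⌋₊ : ℝ)) Ω g < ⊤)

/-! ### Bessel functions of the first kind and their positive zeros -/

/-- The Bessel function of the first kind `J_ν(z)` for real order `ν ≥ 0` and real `z ≥ 0`. -/
def besselJ (ν z : ℝ) : ℝ :=
  ∑' j : ℕ, (-1) ^ j / ((Nat.factorial j : ℝ) * Real.Gamma (ν + (j : ℝ) + 1))
    * (z / 2) ^ (2 * (j : ℝ) + ν)

/-- `μ` is the `m`-th positive zero of `f` in increasing order, `m ≥ 1`: it is a positive zero, and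
there are exactly `m` zeros of `f` in `(0, μ]`. -/
def IsNthPosZero (f : ℝ → ℝ) (m : ℕ) (μ : ℝ) : Prop :=
  0 < μ ∧ f μ = 0 ∧ {x : ℝ | 0 < x ∧ x ≤ μ ∧ f x = 0}.encard = (m : ℕ∞)

/-- There is at most one `m`-th positive zero. -/
theorem IsNthPosZero.unique {f : ℝ → ℝ} {m : ℕ} {μ₁ μ₂ : ℝ}
    (h₁ : IsNthPosZero f m μ₁) (h₂ : IsNthPosZero f m μ₂) : μ₁ = μ₂ := by
  have key : ∀ {a b : ℝ}, IsNthPosZero f m a → IsNthPosZero f m b → ¬ a < b := by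
    intro a b ha hb hab
    have hsub : {x : ℝ | 0 < x ∧ x ≤ a ∧ f x = 0} ⊂ {x : ℝ | 0 < x ∧ x ≤ b ∧ f x = 0} := by
      refine ⟨fun x hx => ⟨hx.1, hx.2.1.trans hab.le, hx.2.2⟩, fun h => ?_⟩
      have hmem : b ∈ {x : ℝ | 0 < x ∧ x ≤ a ∧ f x = 0} := h ⟨hb.1, le_refl b, hb.2.1⟩
      exact absurd hmem.2.1 (not_le.mpr hab)
    have hfin : {x : ℝ | 0 < x ∧ x ≤ a ∧ f x = 0}.Finite :=
      Set.finite_of_encard_eq_coe ha.2.2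
    have hlt := hfin.encard_lt_encard hsub
    rw [ha.2.2, hb.2.2] at hlt
    exact lt_irrefl _ hlt
  exact le_antisymm (not_lt.mp (key h₂ h₁)) (not_lt.mp (key h₁ h₂))

open Classical in
/-- The `m`-th positive zero `μ_{ν,m}` of `J_ν`, for `ν ≥ 0` and `m ≥ 1`. It exists, since `J_ν` has
infinitely many positive zeros and they do not accumulate at a finite point; the value chosen
in the `else` branch is a junk value for other arguments such as `m = 0`. -/
def besselZero (ν : ℝ) (m : ℕ) : ℝ :=
  if h : ∃ μ : ℝ, IsNthPosZero (besselJ ν) m μ then h.choose else 1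

/-! ### Circular sectors and their Laplace eigenfunctions -/

/-- The open circular sector `{(r cos φ, r sin φ) : 0 < r < 1, 0 < φ < ω}`. -/
def circularSector (ω : ℝ) : Set (EuclideanSpace ℝ (Fin 2)) :=
  {x | ∃ r φ : ℝ, 0 < r ∧ r < 1 ∧ 0 < φ ∧ φ < ω ∧ x = !₂[r * Real.cos φ, r * Real.sin φ]}

/-- The polar angle in `[0, 2π)` of a point of the plane. -/
def polarAngle (x : EuclideanSpace ℝ (Fin 2)) : ℝ :=
  toIcoMod Real.two_pi_pos 0 (Complex.arg ⟨x 0, x 1⟩)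

/-- `ν_k = k π / ω`. -/
def angularFreq (ω : ℝ) (k : ℕ) : ℝ := (k : ℝ) * (Real.pi / ω)

/-- The Laplace eigenfunction `u_{ν_k,m}` of the circular sector of angle `ω`, given in polar
coordinates by `J_{ν_k}(μ_{ν_k,m} r) cos(ν_k φ)`. -/
def sectorEigenfunction (ω : ℝ) (k m : ℕ) (x : EuclideanSpace ℝ (Fin 2)) : ℝ :=
  besselJ (angularFreq ω k) (besselZero (angularFreq ω k) m * ‖x‖)
    * Real.cos (angularFreq ω k * polarAngle x)

theorem norm_polar {r : ℝ} (hr : 0 ≤ r) (φ : ℝ) :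
    ‖(!₂[r * Real.cos φ, r * Real.sin φ] : EuclideanSpace ℝ (Fin 2))‖ = r := by
  rw [EuclideanSpace.norm_eq, Fin.sum_univ_two]
  have : ‖(!₂[r * Real.cos φ, r * Real.sin φ] : EuclideanSpace ℝ (Fin 2)) 0‖ ^ 2
      + ‖(!₂[r * Real.cos φ, r * Real.sin φ] : EuclideanSpace ℝ (Fin 2)) 1‖ ^ 2 = r ^ 2 := by
    simp only [Real.norm_eq_abs, sq_abs]
    simp
    nlinarith [Real.sin_sq_add_cos_sq φ]
  rw [this, Real.sqrt_sq hr]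

theorem polarAngle_polar {r φ : ℝ} (hr : 0 < r) (h0 : 0 ≤ φ) (h1 : φ < 2 * Real.pi) :
    polarAngle !₂[r * Real.cos φ, r * Real.sin φ] = φ := by
  have hz : (⟨r * Real.cos φ, r * Real.sin φ⟩ : ℂ)
      = (r : ℂ) * (Complex.cos φ + Complex.sin φ * Complex.I) := by
    apply Complex.ext <;> simp [← Complex.ofReal_cos, ← Complex.ofReal_sin]
  have harg : Complex.arg ⟨r * Real.cos φ, r * Real.sin φ⟩
      = toIocMod Real.two_pi_pos (-Real.pi) φ := by
    rw [hz, Complex.arg_mul_cos_add_sin_mul_I_eq_toIocMod hr]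
  unfold polarAngle
  change toIcoMod Real.two_pi_pos 0 (Complex.arg ⟨r * Real.cos φ, r * Real.sin φ⟩) = φ
  rw [harg, toIocMod, toIcoMod_sub_zsmul]
  exact (toIcoMod_eq_self Real.two_pi_pos).2 ⟨h0, by simpa using h1⟩

/-- The eigenfunction in polar coordinates. -/
theorem sectorEigenfunction_polar (ω : ℝ) (k m : ℕ) {r φ : ℝ} (hr : 0 < r) (h0 : 0 ≤ φ)
    (h1 : φ < 2 * Real.pi) :
    sectorEigenfunction ω k m !₂[r * Real.cos φ, r * Real.sin φ]
      = besselJ (angularFreq ω k) (besselZero (angularFreq ω k) m * r)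
        * Real.cos (angularFreq ω k * φ) := by
  rw [sectorEigenfunction, norm_polar hr.le, polarAngle_polar hr h0 h1]

end

/-!
If `ν = n` is an integer, `J_n(μ r) cos(n φ)` is `Re (zⁿ)` times an entire function of `|z|²`,
hence smooth on the whole plane. Otherwise, on a thin cone `0 < φ < δ`, it is `Re (z ^ ν Q(z))` with
`Q` smooth and `Q(0) ≠ 0`, and its `l`-th derivative in the direction of the `x`-axis is
`Re (z ^ (ν - l) P(z))` with `P(0) = ν (ν - 1) ⋯ (ν - l + 1) Q(0) ≠ 0`, which is comparable to
`r ^ (ν - l)`. If `s ≥ ν + 1`, then for `l = ⌊s⌋` the integral that decides membership in `H^s` is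
bounded below by a multiple of `∫ ‖x‖ ^ (-2)` over a truncated cone. By scale invariance the latter
takes the same positive value on all dyadic annuli, so it diverges.
-/

open scoped Topology

section WeakDerivatives

theorem iteratedFDeriv_fderiv_apply {𝕜 E F : Type*} [NontriviallyNormedField 𝕜]
    [NormedAddCommGroup E] [NormedSpace 𝕜 E] [NormedAddCommGroup F] [NormedSpace 𝕜 F] {n : ℕ}
    {f : E → F} {x : E} (hf : ContDiffAt 𝕜 (n + 1) f x) (v : E) (w : Fin n → E) :
    iteratedFDeriv 𝕜 n (fun y => fderiv 𝕜 f y v) x w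
      = iteratedFDeriv 𝕜 (n + 1) f x (Fin.snoc w v) := by
  rw [iteratedFDeriv_succ_apply_right, Fin.init_snoc, Fin.snoc_last]
  exact congrArg (· w) (ContinuousLinearMap.iteratedFDeriv_comp_left
    (ContinuousLinearMap.apply 𝕜 F v) (hf.fderiv_right le_rfl) le_rfl)

theorem setIntegral_mul_eq_integral_of_tsupport_subset {E : Type*} [TopologicalSpace E]
    [MeasurableSpace E] {μ : Measure E} {Ω : Set E} {f φ : E → ℝ} (hs : tsupport φ ⊆ Ω) :
    ∫ x in Ω, f x * φ x ∂μ = ∫ x, f x * φ x ∂μ :=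
  setIntegral_eq_integral_of_forall_compl_eq_zero fun x hx => by
    rw [image_eq_zero_of_notMem_tsupport fun h => hx (hs h), mul_zero]

theorem integrable_mul_of_locallyIntegrableOn_of_tsupport_subset {E : Type*} [TopologicalSpace E]
    [T2Space E] [MeasurableSpace E] [BorelSpace E] {μ : Measure E}
    {Ω : Set E} {f φ : E → ℝ} (hf : LocallyIntegrableOn f Ω μ) (hφ : Continuous φ)
    (hc : HasCompactSupport φ) (hs : tsupport φ ⊆ Ω) : Integrable (fun x => f x * φ x) μ := by
  have h : IntegrableOn (fun x => f x * φ x) (tsupport φ) μ :=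
    (hf.integrableOn_compact_subset hs hc).mul_continuousOn hφ.continuousOn hc
  exact (integrableOn_iff_integrable_of_support_subset fun x hx =>
    subset_tsupport φ (right_ne_zero_of_mul hx)).1 h

variable {E : Type*} [NormedAddCommGroup E] [NormedSpace ℝ E]

theorem tsupport_iteratedFDeriv_apply_subset {l : ℕ} {φ : E → ℝ} (w : Fin l → E) :
    tsupport (fun x => iteratedFDeriv ℝ l φ x w) ⊆ tsupport φ :=
  (tsupport_comp_subset (g := fun L : ContinuousMultilinearMap ℝ (fun _ : Fin l => E) ℝ => L w)
    rfl _).trans (tsupport_iteratedFDeriv_subset l)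

-- The directions are reversed because each integration by parts takes the outermost derivative
-- of `φ` and makes it the innermost derivative of `u`.
theorem integral_mul_iteratedFDeriv_eq [FiniteDimensional ℝ E] [MeasurableSpace E] [BorelSpace E]
    {μ : Measure E} [μ.IsAddHaarMeasure] {Ω : Set E} (hΩ : IsOpen Ω) {l : ℕ} {u φ : E → ℝ}
    (hu : ContDiffOn ℝ l u Ω) (hφ : ContDiff ℝ l φ) (hc : HasCompactSupport φ)
    (hs : tsupport φ ⊆ Ω) (w : Fin l → E) :
    ∫ x, u x * iteratedFDeriv ℝ l φ x w ∂μ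
      = (-1) ^ l * ∫ x, iteratedFDeriv ℝ l u x (w ∘ Fin.rev) * φ x ∂μ := by
  induction l generalizing u with
  | zero => simp
  | succ l ih =>
    set ψ : E → ℝ := fun x => iteratedFDeriv ℝ l φ x (Fin.tail w)
    have hψd : ContDiff ℝ 1 ψ :=
      (ContinuousMultilinearMap.apply ℝ (fun _ : Fin l => E) ℝ (Fin.tail w)).contDiff.comp
        (hφ.iteratedFDeriv_right (by push_cast; rw [add_comm]))
    have hψt : tsupport ψ ⊆ tsupport φ := tsupport_iteratedFDeriv_apply_subset _
    have hψc : HasCompactSupport ψ := hc.of_isClosed_subset isClosed_closure hψt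
    have hψs : tsupport ψ ⊆ Ω := hψt.trans hs
    have hu₁ : ContDiffOn ℝ l (fun x => fderiv ℝ u x (w 0)) Ω :=
      (hu.fderiv_of_isOpen hΩ (by simp)).clm_apply contDiffOn_const
    have hint {f χ : E → ℝ} (hf : ContinuousOn f Ω) (hχ : Continuous χ)
        (hχs : tsupport χ ⊆ tsupport ψ) : Integrable (fun x => f x * χ x) μ :=
      integrable_mul_of_locallyIntegrableOn_of_tsupport_subset
        (hf.locallyIntegrableOn hΩ.measurableSet) hχ
        (hψc.of_isClosed_subset isClosed_closure hχs) (hχs.trans hψs)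
    calc ∫ x, u x * iteratedFDeriv ℝ (l + 1) φ x w ∂μ
        = ∫ x, u x * fderiv ℝ ψ x (w 0) ∂μ := by
          congr! 3 with x
          have hφl := hφ.differentiable_iteratedFDeriv (m := l) (by norm_cast; simp)
          exact (hφl x).iteratedFDeriv_succ_apply_left'
      _ = -∫ x, fderiv ℝ u x (w 0) * ψ x ∂μ :=
          integral_mul_fderiv_eq_neg_fderiv_mul_of_integrable
            (hint hu₁.continuousOn hψd.continuous subset_rfl)
            (hint hu.continuousOn ((hψd.continuous_fderiv (by simp)).clm_apply continuous_const)
              (tsupport_fderiv_apply_subset ℝ _))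
            (hint hu.continuousOn hψd.continuous subset_rfl)
            (fun x hx => (hu.contDiffAt (hΩ.mem_nhds (hψs hx))).differentiableAt (by simp))
            (fun x _ => hψd.differentiable (by simp) x)
      _ = (-1) ^ (l + 1) * ∫ x, iteratedFDeriv ℝ l (fun y => fderiv ℝ u y (w 0)) x
            (Fin.tail w ∘ Fin.rev) * φ x ∂μ := by
          rw [ih hu₁ (hφ.of_le (by simp)), pow_succ]
          ring
      _ = (-1) ^ (l + 1) * ∫ x, iteratedFDeriv ℝ (l + 1) u x (w ∘ Fin.rev) * φ x ∂μ := by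
          congr! 3 with x
          by_cases hx : x ∈ tsupport φ
          · rw [iteratedFDeriv_fderiv_apply (hu.contDiffAt (hΩ.mem_nhds (hs hx))),
              ← Fin.cons_comp_rev, Fin.cons_self_tail]
          · simp only [image_eq_zero_of_notMem_tsupport hx, mul_zero]

end WeakDerivatives

section Sobolev

variable {d l : ℕ} {σ : ℝ} {Ω Ω' : Set (EuclideanSpace ℝ (Fin d))} {ι : Fin l → Fin d}
  {u g g' : EuclideanSpace ℝ (Fin d) → ℝ}

theorem IsWeakPartialDeriv.mono (h : IsWeakPartialDeriv Ω ι u g) (hsub : Ω' ⊆ Ω) :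
    IsWeakPartialDeriv Ω' ι u g := by
  refine ⟨h.1.mono_set hsub, h.2.1.mono_set hsub, fun φ hφ hc hs => ?_⟩
  have hts := tsupport_iteratedFDeriv_apply_subset (φ := φ)
    (fun i => EuclideanSpace.single (ι i) (1 : ℝ))
  have key := h.2.2 φ hφ hc (hs.trans hsub)
  rw [setIntegral_mul_eq_integral_of_tsupport_subset ((hts.trans hs).trans hsub),
    setIntegral_mul_eq_integral_of_tsupport_subset (hs.trans hsub)] at key
  rwa [setIntegral_mul_eq_integral_of_tsupport_subset (hts.trans hs),
    setIntegral_mul_eq_integral_of_tsupport_subset hs]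

theorem IsWeakPartialDeriv.ae_eq (hg : IsWeakPartialDeriv Ω ι u g)
    (hg' : IsWeakPartialDeriv Ω ι u g') (hΩ : IsOpen Ω) : g =ᵐ[volume.restrict Ω] g' := by
  have key : ∀ᵐ x, x ∈ Ω → g x - g' x = 0 :=
    hΩ.ae_eq_zero_of_integral_contDiff_smul_eq_zero (hg.2.1.sub hg'.2.1) fun φ hφ hc hs => by
      have hint {f : EuclideanSpace ℝ (Fin d) → ℝ} (hf : LocallyIntegrableOn f Ω) :
          Integrable fun x => f x * φ x :=
        integrable_mul_of_locallyIntegrableOn_of_tsupport_subset hf hφ.continuous hc hs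
      have heq : ∫ x in Ω, g x * φ x = ∫ x in Ω, g' x * φ x :=
        mul_left_cancel₀ (pow_ne_zero l (by norm_num : (-1 : ℝ) ≠ 0))
          ((hg.2.2 φ hφ hc hs).symm.trans (hg'.2.2 φ hφ hc hs))
      rw [setIntegral_mul_eq_integral_of_tsupport_subset hs,
        setIntegral_mul_eq_integral_of_tsupport_subset hs] at heq
      simp_rw [smul_eq_mul, mul_comm (φ _), sub_mul]
      rw [integral_sub (hint hg.2.1) (hint hg'.2.1), heq, sub_self]
  rw [Filter.EventuallyEq, ae_restrict_iff' hΩ.measurableSet]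
  filter_upwards [key] with x hx hxΩ
  exact sub_eq_zero.1 (hx hxΩ)

theorem isWeakPartialDeriv_of_contDiffOn (hΩ : IsOpen Ω) (ι : Fin l → Fin d)
    (hu : ContDiffOn ℝ l u Ω) :
    IsWeakPartialDeriv Ω ι u fun x =>
      iteratedFDeriv ℝ l u x fun i => EuclideanSpace.single (ι i.rev) 1 := by
  have hd : ContinuousOn (fun x => iteratedFDeriv ℝ l u x
      fun i => EuclideanSpace.single (ι i.rev) 1) Ω :=
    (ContinuousMultilinearMap.apply ℝ (fun _ : Fin l => EuclideanSpace ℝ (Fin d)) ℝ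
      _).continuous.comp_continuousOn
      (ContinuousOn.continuousOn_iteratedFDeriv hu hΩ le_rfl)
  refine ⟨hu.continuousOn.locallyIntegrableOn hΩ.measurableSet,
    hd.locallyIntegrableOn hΩ.measurableSet, fun φ hφ hc hs => ?_⟩
  rw [setIntegral_mul_eq_integral_of_tsupport_subset
      ((tsupport_iteratedFDeriv_apply_subset _).trans hs),
    setIntegral_mul_eq_integral_of_tsupport_subset hs]
  exact integral_mul_iteratedFDeriv_eq hΩ hu (hφ.of_le (by exact_mod_cast le_top)) hc hs _

theorem slobodeckijEnergy_congr_ae (h : g =ᵐ[volume.restrict Ω] g') :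
    slobodeckijEnergy σ Ω g = slobodeckijEnergy σ Ω g' := by
  refine lintegral_congr_ae ?_
  filter_upwards [h] with x hx
  refine lintegral_congr_ae ?_
  filter_upwards [h] with y hy
  rw [hx, hy]

theorem slobodeckijEnergy_mono_set (h : Ω' ⊆ Ω) (g : EuclideanSpace ℝ (Fin d) → ℝ) :
    slobodeckijEnergy σ Ω' g ≤ slobodeckijEnergy σ Ω g :=
  (lintegral_mono fun _ => lintegral_mono_set h).trans (lintegral_mono_set h)

end Sobolev

section SmoothFunctions

theorem lintegral_ball_norm_rpow_lt_top {E : Type*} [NormedAddCommGroup E] [NormedSpace ℝ E]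
    [FiniteDimensional ℝ E] [MeasurableSpace E] [BorelSpace E] (μ : Measure E)
    [μ.IsAddHaarMeasure] {a : ℝ} (ha : -(Module.finrank ℝ E : ℝ) < a) (R : ℝ) :
    ∫⁻ z in Metric.ball (0 : E) R, ENNReal.ofReal (‖z‖ ^ a) ∂μ < ⊤ := by
  rcases subsingleton_or_nontrivial E with hE | hE
  · have ha0 : a ≠ 0 := by
      rw [Module.finrank_zero_of_subsingleton] at ha
      exact (by simpa using ha : 0 < a).ne'
    have hz (z : E) : ‖z‖ ^ a = 0 := by
      rw [Subsingleton.elim z 0, norm_zero, Real.zero_rpow ha0]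
    simp [hz]
  have hd : 1 ≤ Module.finrank ℝ E := Module.finrank_pos
  have h : IntegrableOn (fun z : E => ‖z‖ ^ a) (Metric.ball 0 R) μ := by
    rw [integrableOn_fun_norm_addHaar μ (f := fun t : ℝ => t ^ a)]
    rcases le_or_gt R 0 with hR | hR
    · simp [Set.Ioo_eq_empty_of_le hR]
    refine ((intervalIntegral.integrableOn_Ioo_rpow_iff (s := (Module.finrank ℝ E : ℝ) - 1 + a)
      hR).2 (by linarith)).congr_fun (fun t ht => ?_) measurableSet_Ioo
    simp only [smul_eq_mul]
    rw [Real.rpow_add ht.1, ← Real.rpow_natCast, Nat.cast_sub hd, Nat.cast_one]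
  exact (hasFiniteIntegral_iff_ofReal (.of_forall fun z => by positivity)).1 h.2

theorem memLp_restrict_of_continuous_of_isBounded {X F : Type*} [PseudoMetricSpace X]
    [ProperSpace X] [MeasurableSpace X] [OpensMeasurableSpace X] [NormedAddCommGroup F]
    {μ : Measure X} [IsFiniteMeasureOnCompacts μ] {f : X → F} (hf : Continuous f) (p : ENNReal)
    {Ω : Set X} (hΩ : Bornology.IsBounded Ω) : MemLp f p (μ.restrict Ω) := by
  obtain ⟨C, hC⟩ := hΩ.isCompact_closure.exists_bound_of_continuousOn hf.continuousOn
  have : Fact (μ (closure Ω) < ⊤) := ⟨hΩ.isCompact_closure.measure_lt_top⟩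
  have h : MemLp f p (μ.restrict (closure Ω)) :=
    MemLp.of_bound hf.aestronglyMeasurable C
      ((ae_restrict_iff' isClosed_closure.measurableSet).2 (.of_forall hC))
  exact h.mono_measure (Measure.restrict_mono_set μ subset_closure)

variable {d : ℕ} {σ : ℝ} {Ω : Set (EuclideanSpace ℝ (Fin d))} {u g : EuclideanSpace ℝ (Fin d) → ℝ}

theorem sq_abs_sub_div_norm_rpow_le_of_lipschitzOnWith {E : Type*} [NormedAddCommGroup E]
    {s : Set E} {f : E → ℝ} {K : NNReal} (hf : LipschitzOnWith K f s) (q : ℝ) {x y : E}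
    (hx : x ∈ s) (hy : y ∈ s) :
    |f x - f y| ^ 2 / ‖x - y‖ ^ q ≤ (K : ℝ) ^ 2 * ‖y - x‖ ^ (2 - q) := by
  rcases eq_or_ne x y with rfl | hxy
  · simpa using by positivity
  have hpos : 0 < ‖x - y‖ := norm_pos_iff.2 (sub_ne_zero.2 hxy)
  have hle : |f x - f y| ≤ K * ‖x - y‖ := by
    simpa [Real.dist_eq, dist_eq_norm] using hf.dist_le_mul x hx y hy
  rw [norm_sub_rev y x, Real.rpow_sub hpos, Real.rpow_two, ← mul_div_assoc, ← mul_pow]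
  gcongr

theorem lintegral_sq_abs_sub_div_norm_rpow_le_of_lipschitzOnWith {E : Type*}
    [NormedAddCommGroup E] [MeasurableSpace E] [BorelSpace E]
    {μ : Measure E} [μ.IsAddRightInvariant] {s : Set E} (hs : MeasurableSet s) {R : ℝ}
    {f : E → ℝ} {K : NNReal} (hf : LipschitzOnWith K f s) (q : ℝ) {x : E} (hx : x ∈ s)
    (hR : s ⊆ Metric.ball x R) :
    ∫⁻ y in s, ENNReal.ofReal (|f x - f y| ^ 2 / ‖x - y‖ ^ q) ∂μ
      ≤ ENNReal.ofReal ((K : ℝ) ^ 2) *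
        ∫⁻ z in Metric.ball 0 R, ENNReal.ofReal (‖z‖ ^ (2 - q)) ∂μ :=
  calc ∫⁻ y in s, ENNReal.ofReal (|f x - f y| ^ 2 / ‖x - y‖ ^ q) ∂μ
      ≤ ∫⁻ y in s, ENNReal.ofReal ((K : ℝ) ^ 2) * ENNReal.ofReal (‖y - x‖ ^ (2 - q)) ∂μ := by
        refine setLIntegral_mono' hs fun y hy => ?_
        rw [← ENNReal.ofReal_mul (by positivity)]
        exact ENNReal.ofReal_le_ofReal
          (sq_abs_sub_div_norm_rpow_le_of_lipschitzOnWith hf q hx hy)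
    _ = ENNReal.ofReal ((K : ℝ) ^ 2) * ∫⁻ y in s, ENNReal.ofReal (‖y - x‖ ^ (2 - q)) ∂μ :=
        lintegral_const_mul' _ _ ENNReal.ofReal_ne_top
    _ ≤ ENNReal.ofReal ((K : ℝ) ^ 2) *
        ∫⁻ y in (· - x) ⁻¹' Metric.ball 0 R, ENNReal.ofReal (‖y - x‖ ^ (2 - q)) ∂μ := by
        gcongr
        exact fun y hy => mem_ball_zero_iff.2 (mem_ball_iff_norm.1 (hR hy))
    _ = ENNReal.ofReal ((K : ℝ) ^ 2) *
        ∫⁻ z in Metric.ball 0 R, ENNReal.ofReal (‖z‖ ^ (2 - q)) ∂μ := by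
        rw [(measurePreserving_sub_right μ x).setLIntegral_comp_preimage measurableSet_ball
          (f := fun z => ENNReal.ofReal (‖z‖ ^ (2 - q))) (by fun_prop)]

theorem slobodeckijEnergy_lt_top_of_lipschitzOnWith (hσ : σ < 1) (hΩ : Bornology.IsBounded Ω)
    (hm : MeasurableSet Ω) {K : NNReal} (hg : LipschitzOnWith K g Ω) :
    slobodeckijEnergy σ Ω g < ⊤ := by
  obtain ⟨R, hR⟩ := Metric.isBounded_iff.1 hΩ
  have hball (x) (hx : x ∈ Ω) : Ω ⊆ Metric.ball x (R + 1) := fun y hy =>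
    Metric.mem_ball.2 ((hR hy hx).trans_lt (lt_add_one R))
  have hfin : ∫⁻ z in Metric.ball (0 : EuclideanSpace ℝ (Fin d)) (R + 1),
      ENNReal.ofReal (‖z‖ ^ (2 - ((d : ℝ) + 2 * σ))) < ⊤ :=
    lintegral_ball_norm_rpow_lt_top volume (by rw [finrank_euclideanSpace_fin]; linarith) _
  calc slobodeckijEnergy σ Ω g
      ≤ ∫⁻ _ in Ω, ENNReal.ofReal ((K : ℝ) ^ 2) *
          ∫⁻ z in Metric.ball (0 : EuclideanSpace ℝ (Fin d)) (R + 1),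
            ENNReal.ofReal (‖z‖ ^ (2 - ((d : ℝ) + 2 * σ))) :=
        setLIntegral_mono' hm fun x hx =>
          lintegral_sq_abs_sub_div_norm_rpow_le_of_lipschitzOnWith hm hg _ hx (hball x hx)
    _ < ⊤ := by
        rw [setLIntegral_const]
        exact ENNReal.mul_lt_top (ENNReal.mul_lt_top ENNReal.ofReal_lt_top hfin)
          hΩ.measure_lt_top

theorem memSobolevSlobodeckij_of_contDiff {s : ℝ} (hΩ : Bornology.IsBounded Ω)
    (hu : ContDiff ℝ (⌊s⌋₊ + 1) u) : MemSobolevSlobodeckij s Ω u := by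
  have hd {j : ℕ} (hj : j ≤ ⌊s⌋₊) (w : Fin j → EuclideanSpace ℝ (Fin d)) :
      ContDiff ℝ 1 fun x => iteratedFDeriv ℝ j u x w :=
    (ContinuousMultilinearMap.apply ℝ (fun _ => EuclideanSpace ℝ (Fin d)) ℝ w).contDiff.comp
      (hu.iteratedFDeriv_right (by rw [add_comm]; gcongr))
  have hweak {j : ℕ} (hj : j ≤ ⌊s⌋₊) (ι : Fin j → Fin d) :=
    (isWeakPartialDeriv_of_contDiffOn isOpen_univ ι
      (hu.of_le (by norm_cast; omega)).contDiffOn).mono (Set.subset_univ Ω)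
  have hL2 {f : EuclideanSpace ℝ (Fin d) → ℝ} (hf : Continuous f) :
      MemLp f 2 (volume.restrict Ω) := memLp_restrict_of_continuous_of_isBounded hf 2 hΩ
  refine ⟨⟨hL2 hu.continuous, fun j hj ι => ⟨_, hweak hj ι, hL2 (hd hj _).continuous⟩⟩,
    fun _ ι => ⟨_, hweak le_rfl ι, hL2 (hd le_rfl _).continuous, ?_⟩⟩
  obtain ⟨R, hR⟩ := hΩ.subset_closedBall 0
  obtain ⟨K, hK⟩ := (hd le_rfl fun i => EuclideanSpace.single (ι i.rev) 1).contDiffOn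
    |>.exists_lipschitzOnWith one_ne_zero (convex_closedBall 0 R) (isCompact_closedBall 0 R)
  exact (slobodeckijEnergy_mono_set hR _).trans_lt
    (slobodeckijEnergy_lt_top_of_lipschitzOnWith (by linarith [Nat.lt_floor_add_one s])
      Metric.isBounded_closedBall Metric.isClosed_closedBall.measurableSet hK)

end SmoothFunctions

section Cones

open scoped Pointwise

theorem exists_inter_norm_preimage_Ioo_subset {E : Type*} [SeminormedAddCommGroup E] {K Ω : Set E}
    (hΩ : Ω ∈ 𝓝[K] 0) :
    ∃ r : ℝ, 0 < r ∧ K ∩ norm ⁻¹' Set.Ioo 0 r ⊆ Ω := by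
  obtain ⟨r, hr, hsub⟩ := Metric.mem_nhdsWithin_iff.1 hΩ
  exact ⟨r, hr, fun x hx => hsub ⟨mem_ball_zero_iff.2 hx.2.2, hx.1⟩⟩

theorem measure_inter_norm_preimage_Ioo_lt_top {E : Type*} [SeminormedAddCommGroup E]
    [ProperSpace E] [MeasurableSpace E] (μ : Measure E) [IsFiniteMeasureOnCompacts μ] {K : Set E}
    (s t : ℝ) : μ (K ∩ norm ⁻¹' Set.Ioo s t) < ⊤ :=
  (measure_mono fun _ hx => mem_ball_zero_iff.2 hx.2.2).trans_lt (measure_ball_lt_top (r := t))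

variable {E : Type*} [NormedAddCommGroup E] [NormedSpace ℝ E]

/-- A nonempty open cone with vertex `0`, the vertex excluded. Convexity is not required. It serves
as the region near a corner in which a function is compared with a power of `‖x‖`. -/
structure IsOpenCone (K : Set E) : Prop where
  isOpen : IsOpen K
  nonempty : K.Nonempty
  zero_notMem : (0 : E) ∉ K
  smul_mem : ∀ {c : ℝ} {x : E}, 0 < c → x ∈ K → c • x ∈ K

namespace IsOpenCone

variable {K : Set E}

theorem norm_pos (hK : IsOpenCone K) {x : E} (hx : x ∈ K) : 0 < ‖x‖ :=
  norm_pos_iff.2 fun h => hK.zero_notMem (h ▸ hx)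

theorem isOpen_inter_norm_preimage_Ioo (hK : IsOpenCone K) (s t : ℝ) :
    IsOpen (K ∩ norm ⁻¹' Set.Ioo s t) :=
  hK.isOpen.inter (isOpen_Ioo.preimage continuous_norm)

theorem smul_mem_iff (hK : IsOpenCone K) {c : ℝ} (hc : 0 < c) {x : E} : c • x ∈ K ↔ x ∈ K :=
  ⟨fun h => by simpa [smul_smul, hc.ne'] using hK.smul_mem (inv_pos.2 hc) h, hK.smul_mem hc⟩

theorem smul_inter_norm_preimage_Ioo (hK : IsOpenCone K) {c : ℝ} (hc : 0 < c) (s t : ℝ) :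
    c • (K ∩ norm ⁻¹' Set.Ioo s t) = K ∩ norm ⁻¹' Set.Ioo (c * s) (c * t) := by
  ext x
  rw [Set.mem_smul_set_iff_inv_smul_mem₀ hc.ne', Set.mem_inter_iff, Set.mem_inter_iff,
    hK.smul_mem_iff (inv_pos.2 hc), Set.mem_preimage, Set.mem_preimage, norm_smul,
    Real.norm_of_nonneg (inv_pos.2 hc).le, Set.mem_Ioo, Set.mem_Ioo, inv_mul_eq_div,
    lt_div_iff₀' hc, div_lt_iff₀' hc]

theorem inter_norm_preimage_Ioo_mem_nhdsWithin (hK : IsOpenCone K) {r : ℝ} (hr : 0 < r) :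
    K ∩ norm ⁻¹' Set.Ioo 0 r ∈ 𝓝[K] 0 :=
  Metric.mem_nhdsWithin_iff.2
    ⟨r, hr, fun _ hx => ⟨hx.2, hK.norm_pos hx.2, mem_ball_zero_iff.1 hx.1⟩⟩

theorem measure_inter_norm_preimage_Ioo_pos [MeasurableSpace E] (μ : Measure E)
    [μ.IsOpenPosMeasure] (hK : IsOpenCone K) {s t : ℝ} (hs : 0 ≤ s) (hst : s < t) :
    0 < μ (K ∩ norm ⁻¹' Set.Ioo s t) := by
  refine (hK.isOpen_inter_norm_preimage_Ioo s t).measure_pos μ ?_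
  obtain ⟨x, hx⟩ := hK.nonempty
  have hx0 := hK.norm_pos hx
  have hst0 : 0 < (s + t) / 2 := by linarith
  refine ⟨((s + t) / 2 / ‖x‖) • x, hK.smul_mem (by positivity) hx, ?_⟩
  rw [Set.mem_preimage, norm_smul, Real.norm_of_nonneg (by positivity),
    div_mul_cancel₀ _ hx0.ne']
  constructor <;> linarith

end IsOpenCone

variable [FiniteDimensional ℝ E] [MeasurableSpace E] [BorelSpace E] (μ : Measure E)
  [μ.IsAddHaarMeasure]

theorem setLIntegral_smul_norm_rpow_neg_finrank {c : ℝ} (hc : 0 < c) (S : Set E) :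
    ∫⁻ x in c • S, ENNReal.ofReal (‖x‖ ^ (-(Module.finrank ℝ E : ℝ))) ∂μ
      = ∫⁻ x in S, ENNReal.ofReal (‖x‖ ^ (-(Module.finrank ℝ E : ℝ))) ∂μ := by
  set n := Module.finrank ℝ E
  have hcn : ENNReal.ofReal (c ^ (-(n : ℝ))) ≠ 0 := (ENNReal.ofReal_pos.2 (by positivity)).ne'
  have hemb : MeasurableEmbedding (c • · : E → E) := measurableEmbedding_const_smul₀ hc.ne'
  refine (ENNReal.mul_right_inj hcn ENNReal.ofReal_ne_top).1 ?_
  calc ENNReal.ofReal (c ^ (-(n : ℝ))) * ∫⁻ x in c • S, ENNReal.ofReal (‖x‖ ^ (-(n : ℝ))) ∂μ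
      = ∫⁻ x in c • S, ENNReal.ofReal (‖x‖ ^ (-(n : ℝ))) ∂(μ.map (c • ·)) := by
        rw [Measure.map_addHaar_smul μ hc.ne', Measure.restrict_smul, lintegral_smul_measure,
          abs_of_pos (by positivity), Real.rpow_neg hc.le, Real.rpow_natCast, smul_eq_mul]
    _ = ∫⁻ x in S, ENNReal.ofReal (‖c • x‖ ^ (-(n : ℝ))) ∂μ := by
        rw [hemb.restrict_map, hemb.lintegral_map, Set.preimage_smul₀ hc.ne',
          inv_smul_smul₀ hc.ne']
    _ = ENNReal.ofReal (c ^ (-(n : ℝ))) * ∫⁻ x in S, ENNReal.ofReal (‖x‖ ^ (-(n : ℝ))) ∂μ := by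
        rw [← lintegral_const_mul' _ _ ENNReal.ofReal_ne_top]
        simp_rw [norm_smul, Real.norm_of_nonneg hc.le, Real.mul_rpow hc.le (norm_nonneg _),
          ENNReal.ofReal_mul (Real.rpow_nonneg hc.le _)]

namespace IsOpenCone

variable {K Ω : Set E} {a : ℝ}

theorem measure_inter_norm_preimage_Ioo_mul (hK : IsOpenCone K) {c : ℝ} (hc : 0 < c) (s t : ℝ) :
    μ (K ∩ norm ⁻¹' Set.Ioo (c * s) (c * t))
      = ENNReal.ofReal (c ^ Module.finrank ℝ E) * μ (K ∩ norm ⁻¹' Set.Ioo s t) := by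
  rw [← hK.smul_inter_norm_preimage_Ioo hc, Measure.addHaar_smul_of_nonneg μ hc.le]

-- Halving the punctured cone `S` does not change the integral, so a finite integral over `S` would
-- leave nothing for the annulus between the two.
theorem lintegral_norm_rpow_neg_finrank_eq_top (hK : IsOpenCone K) {r : ℝ} (hr : 0 < r) :
    ∫⁻ x in K ∩ norm ⁻¹' Set.Ioo 0 r, ENNReal.ofReal (‖x‖ ^ (-(Module.finrank ℝ E : ℝ))) ∂μ
      = ⊤ := by
  set F : E → ENNReal := fun x => ENNReal.ofReal (‖x‖ ^ (-(Module.finrank ℝ E : ℝ)))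
  have hF : Measurable F := by fun_prop
  set A := K ∩ norm ⁻¹' Set.Ioo (r / 2) r
  set S := K ∩ norm ⁻¹' Set.Ioo 0 r
  have hhalf : (1 / 2 : ℝ) • S = K ∩ norm ⁻¹' Set.Ioo 0 (r / 2) := by
    rw [hK.smul_inter_norm_preimage_Ioo one_half_pos, mul_zero, one_div_mul_eq_div]
  have hApos : 0 < ∫⁻ x in A, F x ∂μ := by
    have hsupp : Function.support F ∩ A = A := Set.inter_eq_right.2 fun x hx =>
      (ENNReal.ofReal_pos.2 (Real.rpow_pos_of_pos (hK.norm_pos hx.1) _)).ne'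
    rw [setLIntegral_pos_iff hF, hsupp]
    exact hK.measure_inter_norm_preimage_Ioo_pos μ (by positivity) (half_lt_self hr)
  have hdisj : Disjoint ((1 / 2 : ℝ) • S) A := by
    rw [hhalf]
    exact Set.disjoint_left.2 fun x hx hx' => hx.2.2.not_gt hx'.2.1
  have hsub : (1 / 2 : ℝ) • S ∪ A ⊆ S := by
    rw [hhalf]
    exact Set.union_subset
      (fun x hx => ⟨hx.1, hx.2.1, hx.2.2.trans (half_lt_self hr)⟩)
      (fun x hx => ⟨hx.1, hK.norm_pos hx.1, hx.2.2⟩)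
  by_contra hfin
  have hle : ∫⁻ x in S, F x ∂μ + ∫⁻ x in A, F x ∂μ ≤ ∫⁻ x in S, F x ∂μ :=
    calc ∫⁻ x in S, F x ∂μ + ∫⁻ x in A, F x ∂μ
        = ∫⁻ x in (1 / 2 : ℝ) • S ∪ A, F x ∂μ := by
          rw [lintegral_union (hK.isOpen_inter_norm_preimage_Ioo _ _).measurableSet hdisj,
            setLIntegral_smul_norm_rpow_neg_finrank μ one_half_pos]
      _ ≤ ∫⁻ x in S, F x ∂μ := lintegral_mono_set hsub
  exact (ENNReal.lt_add_right hfin hApos.ne').not_ge hle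

theorem lintegral_norm_rpow_eq_top (hK : IsOpenCone K) (hΩ : Ω ∈ 𝓝[K] 0)
    (ha : a ≤ -Module.finrank ℝ E) : ∫⁻ x in Ω, ENNReal.ofReal (‖x‖ ^ a) ∂μ = ⊤ := by
  obtain ⟨r, hr, hsub⟩ := exists_inter_norm_preimage_Ioo_subset hΩ
  refine top_le_iff.1 ?_
  rw [← hK.lintegral_norm_rpow_neg_finrank_eq_top μ (lt_min hr one_pos)]
  refine (setLIntegral_mono' (hK.isOpen_inter_norm_preimage_Ioo _ _).measurableSet
    fun x hx => ?_).trans (lintegral_mono_set (Set.Subset.trans ?_ hsub))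
  · exact ENNReal.ofReal_le_ofReal (Real.rpow_le_rpow_of_exponent_ge hx.2.1
      (hx.2.2.le.trans (min_le_right _ _)) ha)
  · exact fun x hx => ⟨hx.1, hx.2.1, hx.2.2.trans_le (min_le_left _ _)⟩

theorem not_memLp_of_isBigO {F : Type*} [NormedAddCommGroup F] (hK : IsOpenCone K)
    (hΩ : Ω ∈ 𝓝[K] 0) {g : E → F} (hg : (fun x => ‖x‖ ^ a) =O[𝓝[K] 0] g) {p : ENNReal}
    (hp : p ≠ 0) (hp' : p ≠ ⊤) (ha : a * p.toReal ≤ -Module.finrank ℝ E) :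
    ¬ MemLp g p (μ.restrict Ω) := by
  intro hmem
  obtain ⟨c, hc⟩ := hg.bound
  obtain ⟨r, hr, hsub⟩ := exists_inter_norm_preimage_Ioo_subset (Filter.inter_mem hΩ hc)
  set S := K ∩ norm ⁻¹' Set.Ioo 0 r
  have hpow : MemLp (fun x : E => ‖x‖ ^ a) p (μ.restrict S) :=
    (hmem.mono_measure (Measure.restrict_mono_set μ fun x hx => (hsub hx).1)).of_le_mul
      (by fun_prop : Measurable fun x : E => ‖x‖ ^ a).aestronglyMeasurable
      (ae_restrict_of_forall_mem
        (hK.isOpen_inter_norm_preimage_Ioo _ _).measurableSet fun x hx => (hsub hx).2)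
  refine (lintegral_rpow_enorm_lt_top_of_eLpNorm_lt_top hp hp' hpow.2).ne ?_
  rw [← hK.lintegral_norm_rpow_eq_top μ (hK.inter_norm_preimage_Ioo_mem_nhdsWithin hr) ha]
  refine lintegral_congr fun x => ?_
  rw [Real.enorm_of_nonneg (by positivity), ENNReal.ofReal_rpow_of_nonneg (by positivity)
    ENNReal.toReal_nonneg, ← Real.rpow_mul (norm_nonneg x)]

end IsOpenCone

end Cones

section Corners

theorem exists_one_lt_mul_rpow_le {a ε : ℝ} (ha : a < 0) (hε : 0 < ε) (C : ℝ) :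
    ∃ M : ℝ, 1 < M ∧ C * M ^ a ≤ ε := by
  have hlim : Filter.Tendsto (fun M : ℝ => C * M ^ a) Filter.atTop (𝓝 0) := by
    simpa using (tendsto_rpow_neg_atTop (neg_pos.2 ha)).const_mul C
  exact ((Filter.eventually_gt_atTop 1).and (hlim.eventually_le_const hε)).exists

theorem mul_norm_rpow_le_sq_abs_sub_div_norm_rpow {E : Type*} [NormedAddCommGroup E] {g : E → ℝ}
    {a c C M q : ℝ} {x y : E} (ha : a ≤ 0) (hc : 0 < c) (hC : 0 ≤ C) (hM : 1 ≤ M)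
    (hCM : C * M ^ a ≤ c / 2) (hq : 0 ≤ q) (hx : 0 < ‖x‖) (hxy : ‖x‖ * M < ‖y‖)
    (hyx : ‖y‖ < ‖x‖ * (2 * M)) (hgx : c * ‖x‖ ^ a ≤ |g x|) (hgy : |g y| ≤ C * ‖y‖ ^ a) :
    (c / 2) ^ 2 / (3 * M) ^ q * ‖x‖ ^ (2 * a - q) ≤ |g x - g y| ^ 2 / ‖x - y‖ ^ q := by
  have hM0 : 0 < M := one_pos.trans_le hM
  have hgy' : |g y| ≤ c / 2 * ‖x‖ ^ a :=
    calc |g y| ≤ C * (‖x‖ * M) ^ a :=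
          hgy.trans (mul_le_mul_of_nonneg_left
            (Real.rpow_le_rpow_of_nonpos (by positivity) hxy.le ha) hC)
      _ = C * M ^ a * ‖x‖ ^ a := by rw [Real.mul_rpow hx.le hM0.le]; ring
      _ ≤ c / 2 * ‖x‖ ^ a := by gcongr
  have hnum : c / 2 * ‖x‖ ^ a ≤ |g x - g y| := by
    linarith [abs_sub_abs_le_abs_sub (g x) (g y)]
  have hpos : 0 < ‖x - y‖ := by
    rw [norm_sub_rev]
    exact (sub_pos.2 ((le_mul_of_one_le_right hx.le hM).trans_lt hxy)).trans_le
      (norm_sub_norm_le y x)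
  have hden : ‖x - y‖ ≤ 3 * M * ‖x‖ := by nlinarith [norm_sub_le x y]
  calc (c / 2) ^ 2 / (3 * M) ^ q * ‖x‖ ^ (2 * a - q)
      = (c / 2 * ‖x‖ ^ a) ^ 2 / (3 * M * ‖x‖) ^ q := by
        rw [Real.rpow_sub hx, mul_comm 2 a, Real.rpow_mul hx.le, Real.rpow_two,
          Real.mul_rpow (by positivity) hx.le, mul_pow]
        field_simp
    _ ≤ |g x - g y| ^ 2 / ‖x - y‖ ^ q := by gcongr

theorem IsOpenCone.le_setLIntegral_of_mul_rpow_le {E : Type*} [NormedAddCommGroup E]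
    [NormedSpace ℝ E] [FiniteDimensional ℝ E] [MeasurableSpace E] [BorelSpace E] (μ : Measure E)
    [μ.IsAddHaarMeasure] {K : Set E} (hK : IsOpenCone K) {f : E → ℝ} {k b t M N : ℝ}
    (hk : 0 ≤ k) (ht : 0 < t)
    (hf : ∀ y ∈ K ∩ norm ⁻¹' Set.Ioo (t * M) (t * N), k * t ^ b ≤ f y) :
    ENNReal.ofReal k * μ (K ∩ norm ⁻¹' Set.Ioo M N)
        * ENNReal.ofReal (t ^ (b + Module.finrank ℝ E))
      ≤ ∫⁻ y in K ∩ norm ⁻¹' Set.Ioo (t * M) (t * N), ENNReal.ofReal (f y) ∂μ :=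
  calc ENNReal.ofReal k * μ (K ∩ norm ⁻¹' Set.Ioo M N)
        * ENNReal.ofReal (t ^ (b + Module.finrank ℝ E))
      = ∫⁻ _ in K ∩ norm ⁻¹' Set.Ioo (t * M) (t * N), ENNReal.ofReal (k * t ^ b) ∂μ := by
        rw [setLIntegral_const, hK.measure_inter_norm_preimage_Ioo_mul μ ht, Real.rpow_add ht,
          Real.rpow_natCast, ENNReal.ofReal_mul hk, ENNReal.ofReal_mul (by positivity)]
        ring
    _ ≤ ∫⁻ y in K ∩ norm ⁻¹' Set.Ioo (t * M) (t * N), ENNReal.ofReal (f y) ∂μ :=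
        setLIntegral_mono' (hK.isOpen_inter_norm_preimage_Ioo _ _).measurableSet fun y hy =>
          ENNReal.ofReal_le_ofReal (hf y hy)

variable {d : ℕ} {K Ω : Set (EuclideanSpace ℝ (Fin d))} {u g : EuclideanSpace ℝ (Fin d) → ℝ}
  {a s σ : ℝ}

-- Points `y` at distance about `M ‖x‖` from the vertex, with `M` so large that `|g y|` is at most
-- half of `|g x|`, already give the inner integral the size `‖x‖ ^ (2 * a - 2 * σ)`.
theorem slobodeckijEnergy_inter_norm_preimage_Ioo_eq_top (hK : IsOpenCone K) {r c C : ℝ}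
    (hr : 0 < r) (hc : 0 < c) (hC : 0 ≤ C)
    (hgc : ∀ x ∈ K ∩ norm ⁻¹' Set.Ioo 0 r, c * ‖x‖ ^ a ≤ |g x|)
    (hgC : ∀ x ∈ K ∩ norm ⁻¹' Set.Ioo 0 r, |g x| ≤ C * ‖x‖ ^ a)
    (ha : a < 0) (hσ : 0 ≤ σ) (haσ : a + d / 2 ≤ σ) :
    slobodeckijEnergy σ (K ∩ norm ⁻¹' Set.Ioo 0 r) g = ⊤ := by
  obtain ⟨M, hM, hCM⟩ := exists_one_lt_mul_rpow_le ha (half_pos hc) C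
  have hM0 : 0 < M := one_pos.trans hM
  set q : ℝ := d + 2 * σ
  set k : ℝ := (c / 2) ^ 2 / (3 * M) ^ q
  have hk : 0 < k := by positivity
  set V := volume (K ∩ norm ⁻¹' Set.Ioo M (2 * M))
  have hV : 0 < V := hK.measure_inter_norm_preimage_Ioo_pos volume hM0.le (by linarith)
  have hV' : V ≠ ⊤ := (measure_inter_norm_preimage_Ioo_lt_top volume M (2 * M)).ne
  set S := K ∩ norm ⁻¹' Set.Ioo 0 (r / (2 * M))
  have hSr : S ⊆ K ∩ norm ⁻¹' Set.Ioo 0 r := fun x hx =>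
    ⟨hx.1, hx.2.1, hx.2.2.trans_le (div_le_self hr.le (by linarith))⟩
  have hA {x} (hx : x ∈ S) :
      K ∩ norm ⁻¹' Set.Ioo (‖x‖ * M) (‖x‖ * (2 * M)) ⊆ K ∩ norm ⁻¹' Set.Ioo 0 r := fun y hy =>
    ⟨hy.1, hK.norm_pos hy.1, hy.2.2.trans ((lt_div_iff₀ (by positivity)).1 hx.2.2)⟩
  have hinner (x) (hx : x ∈ S) : ENNReal.ofReal k * V * ENNReal.ofReal (‖x‖ ^ (2 * a - q + d))
      ≤ ∫⁻ y in K ∩ norm ⁻¹' Set.Ioo 0 r,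
        ENNReal.ofReal (|g x - g y| ^ 2 / ‖x - y‖ ^ q) := by
    have hle := hK.le_setLIntegral_of_mul_rpow_le volume hk.le (hK.norm_pos hx.1) fun y hy =>
      mul_norm_rpow_le_sq_abs_sub_div_norm_rpow ha.le hc hC hM.le hCM (by positivity)
        (hK.norm_pos hx.1) hy.2.1 hy.2.2 (hgc x (hSr hx)) (hgC y (hA hx hy))
    rw [finrank_euclideanSpace_fin] at hle
    exact hle.trans (lintegral_mono_set (hA hx))
  refine top_le_iff.1 ?_
  calc (⊤ : ENNReal)
      = ∫⁻ x in S, ENNReal.ofReal k * V * ENNReal.ofReal (‖x‖ ^ (2 * a - q + d)) := by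
        rw [lintegral_const_mul' _ _ (ENNReal.mul_ne_top ENNReal.ofReal_ne_top hV'),
          hK.lintegral_norm_rpow_eq_top volume
            (hK.inter_norm_preimage_Ioo_mem_nhdsWithin (by positivity))
            (by rw [finrank_euclideanSpace_fin]; linarith),
          ENNReal.mul_top (mul_ne_zero (ENNReal.ofReal_pos.2 hk).ne' hV.ne')]
    _ ≤ ∫⁻ x in S, ∫⁻ y in K ∩ norm ⁻¹' Set.Ioo 0 r,
          ENNReal.ofReal (|g x - g y| ^ 2 / ‖x - y‖ ^ q) :=
        setLIntegral_mono' (hK.isOpen_inter_norm_preimage_Ioo _ _).measurableSet hinner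
    _ ≤ slobodeckijEnergy σ (K ∩ norm ⁻¹' Set.Ioo 0 r) g := lintegral_mono_set hSr

theorem slobodeckijEnergy_eq_top_of_isTheta (hK : IsOpenCone K) (hΩ : Ω ∈ 𝓝[K] 0)
    (hg : g =Θ[𝓝[K] 0] fun x => ‖x‖ ^ a) (ha : a < 0) (hσ : 0 ≤ σ) (haσ : a + d / 2 ≤ σ) :
    slobodeckijEnergy σ Ω g = ⊤ := by
  obtain ⟨C, hC, hgC⟩ := hg.1.exists_pos
  obtain ⟨c, hc, hgc⟩ := hg.2.exists_pos
  obtain ⟨r, hr, hsub⟩ := exists_inter_norm_preimage_Ioo_subset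
    (Filter.inter_mem hΩ (hgC.bound.and hgc.bound))
  have hpow (x : EuclideanSpace ℝ (Fin d)) : ‖‖x‖ ^ a‖ = ‖x‖ ^ a :=
    Real.norm_of_nonneg (by positivity)
  refine top_le_iff.1 ((slobodeckijEnergy_inter_norm_preimage_Ioo_eq_top hK hr (inv_pos.2 hc)
    hC.le (fun x hx => ?_) (fun x hx => ?_) ha hσ haσ).ge.trans
      (slobodeckijEnergy_mono_set (fun x hx => (hsub hx).1) g))
  · rw [inv_mul_le_iff₀ hc, ← hpow]
    exact (hsub hx).2.2
  · rw [← hpow x]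
    exact (hsub hx).2.1

theorem not_memSobolevSlobodeckij_of_isTheta (hK : IsOpenCone K) (hΩ : Ω ∈ 𝓝[K] 0)
    (hu : ∀ᶠ x in 𝓝[K] 0, ContDiffAt ℝ ⌊s⌋₊ u x) (ι : Fin ⌊s⌋₊ → Fin d)
    (hd : (fun x => iteratedFDeriv ℝ ⌊s⌋₊ u x fun i => EuclideanSpace.single (ι i.rev) 1)
      =Θ[𝓝[K] 0] fun x => ‖x‖ ^ a)
    (ha : a < 0) (hs : 0 ≤ s) (has : a + d / 2 ≤ s - ⌊s⌋₊) :
    ¬ MemSobolevSlobodeckij s Ω u := by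
  rintro ⟨hL2, hfrac⟩
  obtain ⟨r, hr, hsub⟩ := exists_inter_norm_preimage_Ioo_subset (Filter.inter_mem hΩ hu)
  set S := K ∩ norm ⁻¹' Set.Ioo 0 r
  have hS : S ∈ 𝓝[K] 0 := hK.inter_norm_preimage_Ioo_mem_nhdsWithin hr
  have hSΩ : S ⊆ Ω := fun x hx => (hsub hx).1
  have hSo : IsOpen S := hK.isOpen_inter_norm_preimage_Ioo 0 r
  have hcd : ContDiffOn ℝ ⌊s⌋₊ u S := fun x hx =>
    have hx : ContDiffAt ℝ ⌊s⌋₊ u x := (hsub hx).2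
    hx.contDiffWithinAt
  have hae {g} (hg : IsWeakPartialDeriv Ω ι u g) := (hg.mono hSΩ).ae_eq
    (isWeakPartialDeriv_of_contDiffOn hSo ι hcd) hSo
  by_cases hfloor : s = ⌊s⌋₊
  · obtain ⟨g, hg, hgL2⟩ := hL2.2 _ le_rfl ι
    refine hK.not_memLp_of_isBigO volume hS hd.2 two_ne_zero ENNReal.ofNat_ne_top ?_
      ((memLp_congr_ae (hae hg)).1 (hgL2.mono_measure (Measure.restrict_mono_set _ hSΩ)))
    rw [finrank_euclideanSpace_fin, ENNReal.toReal_ofNat]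
    linarith
  · obtain ⟨g, hg, -, hfin⟩ := hfrac hfloor ι
    refine ((slobodeckijEnergy_mono_set hSΩ g).trans_lt hfin).ne ?_
    rw [slobodeckijEnergy_congr_ae (hae hg)]
    exact slobodeckijEnergy_eq_top_of_isTheta hK hS hd ha
      (sub_nonneg.2 (Nat.floor_le hs)) has

end Corners

section Bessel

variable {ν : ℝ}

/-- The Bessel–Clifford function `C_ν(t) = ∑ tʲ / (j! Γ(ν + j + 1))`, which carries the regular part
of the Bessel function: `J_ν(z) = (z/2)^ν C_ν(-(z/2)²)`. -/
noncomputable def besselClifford (ν : ℝ) : ℝ → ℝ :=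
  FormalMultilinearSeries.ofScalarsSum fun j : ℕ => (j.factorial * Real.Gamma (ν + j + 1))⁻¹

theorem factorial_mul_Gamma_pos (hν : -1 < ν) (j : ℕ) :
    0 < j.factorial * Real.Gamma (ν + j + 1) :=
  mul_pos (mod_cast j.factorial_pos) (Real.Gamma_pos_of_pos (by linarith [j.cast_nonneg (α := ℝ)]))

theorem factorial_succ_mul_Gamma (hν : -1 < ν) (j : ℕ) :
    (j + 1).factorial * Real.Gamma (ν + (j + 1 : ℕ) + 1)
      = (j + 1) * (ν + j + 1) * (j.factorial * Real.Gamma (ν + j + 1)) := by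
  have hpos : 0 < ν + j + 1 := by linarith [j.cast_nonneg (α := ℝ)]
  rw [show ν + (j + 1 : ℕ) + 1 = ν + j + 1 + 1 by push_cast; ring, Real.Gamma_add_one hpos.ne',
    Nat.factorial_succ]
  push_cast
  ring

theorem tendsto_norm_inv_factorial_mul_Gamma_ratio (hν : -1 < ν) :
    Filter.Tendsto (fun j : ℕ => ‖(j.succ.factorial * Real.Gamma (ν + j.succ + 1))⁻¹‖
      / ‖(j.factorial * Real.Gamma (ν + j + 1))⁻¹‖) Filter.atTop (𝓝 0) := by
  have hratio (j : ℕ) : ‖(j.succ.factorial * Real.Gamma (ν + j.succ + 1))⁻¹‖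
      / ‖(j.factorial * Real.Gamma (ν + j + 1))⁻¹‖ = (j + 1 : ℝ)⁻¹ * (ν + j + 1)⁻¹ := by
    have h := factorial_mul_Gamma_pos hν j
    rw [← norm_div, Nat.succ_eq_add_one, factorial_succ_mul_Gamma hν, mul_inv,
      mul_div_cancel_right₀ _ (inv_ne_zero h.ne'), mul_inv, Real.norm_of_nonneg]
    have : 0 ≤ ν + j + 1 := by linarith [j.cast_nonneg (α := ℝ)]
    positivity
  simp_rw [hratio]
  have h {b : ℝ} : Filter.Tendsto (fun j : ℕ => (j + b)⁻¹) Filter.atTop (𝓝 0) :=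
    tendsto_inv_atTop_zero.comp
      (Filter.tendsto_atTop_add_const_right _ b tendsto_natCast_atTop_atTop)
  simpa only [add_assoc, add_comm ν, add_left_comm ν, mul_zero] using
    (h (b := 1)).mul (h (b := 1 + ν))

theorem contDiff_besselClifford (hν : -1 < ν) {n : WithTop ℕ∞} :
    ContDiff ℝ n (besselClifford ν) := by
  have hr : (FormalMultilinearSeries.ofScalars ℝ
      fun j : ℕ => (j.factorial * Real.Gamma (ν + j + 1))⁻¹).radius = ⊤ :=
    FormalMultilinearSeries.ofScalars_radius_eq_top_of_tendsto ℝ _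
      (.of_forall fun j => inv_ne_zero (factorial_mul_Gamma_pos hν j).ne')
      (tendsto_norm_inv_factorial_mul_Gamma_ratio hν)
  have hball := FormalMultilinearSeries.hasFPowerSeriesOnBall _ (hr.symm ▸ ENNReal.zero_lt_top)
  rw [hr] at hball
  have han := hball.analyticOnNhd
  rw [Metric.eball_top] at han
  exact contDiffOn_univ.1 (han.contDiffOn uniqueDiffOn_univ)

theorem besselClifford_zero_ne_zero (hν : -1 < ν) : besselClifford ν 0 ≠ 0 := by
  simpa [besselClifford, FormalMultilinearSeries.ofScalarsSum_zero] using
    (Real.Gamma_pos_of_pos (by linarith : 0 < ν + 1)).ne'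

theorem besselJ_eq_rpow_mul_besselClifford {z : ℝ} (hν : 0 ≤ ν) (hz : 0 ≤ z) :
    besselJ ν z = (z / 2) ^ ν * besselClifford ν (-(z / 2) ^ 2) := by
  rw [besselClifford, FormalMultilinearSeries.ofScalarsSum_eq_tsum, besselJ, ← tsum_mul_left]
  refine tsum_congr fun j => ?_
  rw [Real.rpow_add_of_nonneg (by positivity) (by positivity) hν, smul_eq_mul,
    neg_pow ((z / 2) ^ 2), ← pow_mul, ← Real.rpow_natCast (z / 2)]
  push_cast
  ring

theorem besselZero_pos (ν : ℝ) (m : ℕ) : 0 < besselZero ν m := by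
  unfold besselZero
  split_ifs with h
  · exact h.choose_spec.1
  · exact one_pos

end Bessel

section ComplexPowers

open Complex Asymptotics
open scoped ContDiff

variable {a : ℂ} {Q : ℂ → ℂ} {z : ℂ}

theorem contDiffAt_cpow_mul {n : WithTop ℕ∞} (hz : z ∈ slitPlane) (hQ : ContDiffAt ℝ n Q z) :
    ContDiffAt ℝ n (fun w => w ^ a * Q w) z :=
  (((analyticAt_id.cpow analyticAt_const hz).contDiffAt (n := n)).restrict_scalars ℝ).mul hQ

theorem fderiv_cpow_mul_apply_one (hz : z ∈ slitPlane) (hQ : DifferentiableAt ℝ Q z) :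
    fderiv ℝ (fun w => w ^ a * Q w) z 1 = z ^ (a - 1) * (a * Q z + z * fderiv ℝ Q z 1) := by
  have hpow : HasDerivAt (fun w : ℂ => w ^ a) (a * z ^ (a - 1)) z := by
    simpa using (hasDerivAt_id z).cpow_const (c := a) hz
  have hmul := (hpow.hasFDerivAt.restrictScalars ℝ).mul hQ.hasFDerivAt
  have hz0 : z ^ a = z ^ (a - 1) * z := by
    rw [cpow_sub _ _ (slitPlane_ne_zero hz), cpow_one, div_mul_cancel₀ _ (slitPlane_ne_zero hz)]
  refine (congrArg (· 1) hmul.fderiv).trans ?_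
  simp [hz0]
  ring

theorem ofReal_eval_descPochhammer (l : ℕ) (x : ℝ) :
    (((descPochhammer ℝ l).eval x : ℝ) : ℂ) = (descPochhammer ℂ l).eval (x : ℂ) := by
  rw [← descPochhammer_map ofRealHom, Polynomial.eval_map, ← ofRealHom_eq_coe,
    ← ofRealHom_eq_coe, Polynomial.eval₂_at_apply]

theorem eval_descPochhammer_ne_zero {R : Type*} [Ring R] [IsDomain R] {x : R} {l : ℕ}
    (hx : ∀ i < l, x ≠ i) : (descPochhammer R l).eval x ≠ 0 := by
  induction l with
  | zero => simp
  | succ l ih =>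
    rw [descPochhammer_succ_eval]
    exact mul_ne_zero (ih fun i hi => hx i (hi.trans l.lt_succ_self))
      (sub_ne_zero.2 (hx l l.lt_succ_self))

theorem exists_iteratedFDeriv_cpow_mul_eqOn (a : ℂ) (hQ : ContDiff ℝ ∞ Q) (l : ℕ) :
    ∃ P : ℂ → ℂ, Continuous P ∧ P 0 = (descPochhammer ℂ l).eval a * Q 0 ∧
      Set.EqOn (fun z => iteratedFDeriv ℝ l (fun w => w ^ a * Q w) z fun _ => 1)
        (fun z => z ^ (a - l) * P z) slitPlane := by
  induction l generalizing a Q with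
  | zero => exact ⟨Q, hQ.continuous, by simp, fun z _ => by simp⟩
  | succ l ih =>
    obtain ⟨P, hP, hP0, hPeq⟩ := ih (Q := fun w => a * Q w + w * fderiv ℝ Q w 1) (a - 1)
      ((contDiff_const.mul hQ).add
        (contDiff_id.mul ((hQ.fderiv_right (m := ∞) le_rfl).clm_apply contDiff_const)))
    refine ⟨P, hP, ?_, fun z hz => ?_⟩
    · rw [hP0, descPochhammer_succ_left]
      simp
      ring
    · have hfd : (fun y => fderiv ℝ (fun w => w ^ a * Q w) y 1)
          =ᶠ[𝓝 z] fun w => w ^ (a - 1) * (a * Q w + w * fderiv ℝ Q w 1) :=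
        Filter.eventuallyEq_of_mem (isOpen_slitPlane.mem_nhds hz) fun y hy =>
          fderiv_cpow_mul_apply_one hy (hQ.differentiable (by simp) y)
      calc iteratedFDeriv ℝ (l + 1) (fun w => w ^ a * Q w) z (fun _ => 1)
          = iteratedFDeriv ℝ l (fun y => fderiv ℝ (fun w => w ^ a * Q w) y 1) z fun _ => 1 := by
            rw [iteratedFDeriv_fderiv_apply (contDiffAt_cpow_mul hz
              (hQ.of_le (by exact_mod_cast le_top)).contDiffAt)]
            congr
            ext i
            refine Fin.lastCases ?_ (fun i => ?_) i <;> simp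
        _ = z ^ (a - 1 - l) * P z := by
            rw [hfd.iteratedFDeriv ℝ l |>.eq_of_nhds]
            exact hPeq hz
        _ = z ^ (a - (l + 1 : ℕ)) * P z := by
            push_cast
            ring_nf

theorem isTheta_re_cpow_mul {a p : ℝ} {P : ℂ → ℂ} {L : Filter ℂ} (hP : Filter.Tendsto P L (𝓝 p))
    (hp : p ≠ 0) (harg : ∀ᶠ z in L, |arg z * a| ≤ 1) :
    (fun z => (z ^ (a : ℂ) * P z).re) =Θ[L] fun z => ‖z‖ ^ a := by
  have hcos : (fun z => Real.cos (arg z * a)) =Θ[L] fun _ => (1 : ℝ) := by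
    refine ⟨isBigO_iff.2 ⟨1, .of_forall fun z => ?_⟩, isBigO_iff.2 ⟨2, ?_⟩⟩
    · simpa using Real.abs_cos_le_one _
    · filter_upwards [harg] with z hz
      have h := (sq_le_one_iff_abs_le_one _).2 hz
      rw [norm_one, Real.norm_eq_abs]
      linarith [Real.one_sub_sq_div_two_le_cos (x := arg z * a), le_abs_self (Real.cos (arg z * a))]
  have hmain : (fun z => p * (‖z‖ ^ a * Real.cos (arg z * a))) =Θ[L] fun z => ‖z‖ ^ a := by
    refine (isTheta_const_mul_left hp).2 ?_
    simpa using (isTheta_refl (fun z : ℂ => ‖z‖ ^ a) L).mul hcos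
  have hpow : (fun z : ℂ => z ^ (a : ℂ)) =O[L] fun z => ‖z‖ ^ a :=
    isBigO_of_le _ fun z => by rw [norm_cpow_real, Real.norm_of_nonneg (by positivity)]
  have herr : (fun z => (z ^ (a : ℂ) * (P z - p)).re) =o[L] fun z => ‖z‖ ^ a := by
    have h : (fun z => P z - p) =o[L] fun _ => (1 : ℝ) :=
      (isLittleO_one_iff ℝ).2 (by simpa using hP.sub_const (p : ℂ))
    have hre : (fun z => (z ^ (a : ℂ) * (P z - p)).re) =O[L] fun z => z ^ (a : ℂ) * (P z - p) :=
      isBigO_of_le _ fun z => abs_re_le_norm _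
    refine hre.trans_isLittleO ?_
    simpa only [mul_one] using hpow.mul_isLittleO h
  have hsplit : (fun z => (z ^ (a : ℂ) * P z).re)
      = (fun z => p * (‖z‖ ^ a * Real.cos (arg z * a)))
        + fun z => (z ^ (a : ℂ) * (P z - p)).re := by
    funext z
    rw [Pi.add_apply, ← cpow_ofReal_re, mul_sub, sub_re, re_mul_ofReal]
    ring
  rw [hsplit]
  exact hmain.add_isLittleO herr

end ComplexPowers

section Plane

/-- The isometry `(x, y) ↦ x + iy`, which identifies the Euclidean plane with `ℂ` so that fractional
powers can be differentiated as complex powers. -/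
noncomputable def toComplex : EuclideanSpace ℝ (Fin 2) ≃ₗᵢ[ℝ] ℂ :=
  Complex.orthonormalBasisOneI.repr.symm

theorem toComplex_apply (x : EuclideanSpace ℝ (Fin 2)) : toComplex x = ⟨x 0, x 1⟩ := by
  have h := Complex.orthonormalBasisOneI.sum_repr_symm x
  rw [toComplex, ← h]
  apply Complex.ext <;> simp [Fin.sum_univ_two]

theorem toComplex_single_zero_one : toComplex (EuclideanSpace.single 0 1) = 1 := by
  rw [toComplex_apply]
  apply Complex.ext <;> simp

theorem polarAngle_eq_arg {x : EuclideanSpace ℝ (Fin 2)} (h : 0 ≤ (toComplex x).arg) :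
    polarAngle x = (toComplex x).arg := by
  rw [polarAngle, ← toComplex_apply, toIcoMod_eq_self Real.two_pi_pos]
  exact ⟨h, by linarith [Complex.arg_le_pi (toComplex x), Real.pi_pos]⟩

theorem cos_nat_mul_polarAngle (n : ℕ) (x : EuclideanSpace ℝ (Fin 2)) :
    Real.cos (n * polarAngle x) = Real.cos (n * (toComplex x).arg) := by
  rw [polarAngle, ← toComplex_apply, toIcoMod, zsmul_eq_mul, mul_sub,
    show (n : ℝ) * ((toIcoDiv Real.two_pi_pos 0 (toComplex x).arg : ℤ) * (2 * Real.pi))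
      = ((n * toIcoDiv Real.two_pi_pos 0 (toComplex x).arg : ℤ) : ℝ) * (2 * Real.pi) by
        push_cast; ring, Real.cos_sub_int_mul_two_pi]

theorem iteratedFDeriv_re_comp_toComplex {G : ℂ → ℂ} {l : ℕ} {x : EuclideanSpace ℝ (Fin 2)}
    (hG : ContDiffAt ℝ l G (toComplex x)) (v : Fin l → EuclideanSpace ℝ (Fin 2)) :
    iteratedFDeriv ℝ l (fun y => (G (toComplex y)).re) x v
      = (iteratedFDeriv ℝ l G (toComplex x) fun i => toComplex (v i)).re := by
  have hleft := Complex.reCLM.iteratedFDeriv_comp_left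
    (hG.comp x toComplex.contDiff.contDiffAt) le_rfl
  have hright := toComplex.toContinuousLinearEquiv.iteratedFDerivWithin_comp_right G
    uniqueDiffOn_univ (Set.mem_univ (toComplex x)) l
  rw [Set.preimage_univ, iteratedFDerivWithin_univ, iteratedFDerivWithin_univ] at hright
  exact (congrArg (· v) hleft).trans (congrArg (fun T => (T v).re) hright)

/-- The open cone of points of the plane whose polar angle lies strictly between `0` and `δ`, in
terms of the principal argument; it is the half-plane `y > 0` for `δ ≥ π`. -/
def angularCone (δ : ℝ) : Set (EuclideanSpace ℝ (Fin 2)) :=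
  toComplex ⁻¹' (Complex.slitPlane ∩ Complex.arg ⁻¹' Set.Ioo 0 δ)

theorem isOpenCone_angularCone {δ : ℝ} (hδ : 0 < δ) : IsOpenCone (angularCone δ) where
  isOpen := (Complex.continuousOn_arg.isOpen_inter_preimage Complex.isOpen_slitPlane
    isOpen_Ioo).preimage toComplex.continuous
  nonempty := by
    have hπ := Real.pi_pos
    obtain ⟨θ, hθ, hθlt⟩ := exists_between (lt_min hδ hπ)
    obtain ⟨hθδ, hθπ⟩ := lt_min_iff.1 hθlt
    have harg : (Complex.cos θ + Complex.sin θ * Complex.I).arg = θ :=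
      Complex.arg_cos_add_sin_mul_I ⟨by linarith, hθπ.le⟩
    refine toComplex.surjective.nonempty_preimage.2
      ⟨Complex.cos θ + Complex.sin θ * Complex.I, Complex.mem_slitPlane_iff_arg.2 ⟨?_, fun h => ?_⟩,
        Set.mem_preimage.2 (harg.symm ▸ ⟨hθ, hθδ⟩)⟩
    · exact harg.symm ▸ hθπ.ne
    · rw [h, Complex.arg_zero] at harg
      exact hθ.ne harg
  zero_notMem h := Complex.slitPlane_ne_zero h.1 (map_zero toComplex)
  smul_mem {c x} hc hx := by
    have h : toComplex (c • x) = c * toComplex x := by simp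
    rw [angularCone, Set.mem_preimage, h, Set.mem_inter_iff, Complex.mem_slitPlane_iff_arg,
      Set.mem_preimage, Complex.arg_real_mul _ hc]
    exact ⟨⟨(Complex.mem_slitPlane_iff_arg.1 hx.1).1,
      mul_ne_zero (by exact_mod_cast hc.ne') (Complex.slitPlane_ne_zero hx.1)⟩, hx.2⟩

theorem circularSector_subset_ball (ω : ℝ) : circularSector ω ⊆ Metric.ball 0 1 := by
  rintro x ⟨r, φ, hr, hr1, -, -, rfl⟩
  rwa [mem_ball_zero_iff, norm_polar hr.le]

theorem circularSector_mem_nhdsWithin_angularCone {δ ω : ℝ} (h : δ ≤ ω) :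
    circularSector ω ∈ 𝓝[angularCone δ] 0 := by
  refine Metric.mem_nhdsWithin_iff.2 ⟨1, one_pos, fun x ⟨hx1, hslit, harg⟩ => ?_⟩
  refine ⟨‖x‖, (toComplex x).arg, ?_, mem_ball_zero_iff.1 hx1, harg.1, harg.2.trans_le h, ?_⟩
  · rw [← toComplex.norm_map]
    exact norm_pos_iff.2 (Complex.slitPlane_ne_zero hslit)
  · rw [← toComplex.norm_map, Complex.norm_mul_cos_arg, Complex.norm_mul_sin_arg, toComplex_apply]
    ext i
    fin_cases i <;> rfl

end Plane

section BesselModes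

/-- The function `J_ν(μ r) cos(ν φ)` in polar coordinates of the plane, with an arbitrary order `ν`
and an arbitrary frequency `μ` in place of a zero of `J_ν`. -/
noncomputable def besselMode (ν μ : ℝ) (x : EuclideanSpace ℝ (Fin 2)) : ℝ :=
  besselJ ν (μ * ‖x‖) * Real.cos (ν * polarAngle x)

/-- The smooth factor `Q(z) = (μ/2)^ν C_ν(-(μ|z|/2)²)` in the representation `Re (z^ν Q(z))` of
`besselMode ν μ`. -/
noncomputable def besselModeFactor (ν μ : ℝ) (z : ℂ) : ℝ :=
  (μ / 2) ^ ν * besselClifford ν (-(μ * ‖z‖ / 2) ^ 2)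

variable {ν μ : ℝ}

theorem contDiff_ofReal_besselModeFactor {n : WithTop ℕ∞} (hν : -1 < ν) :
    ContDiff ℝ n fun z => (besselModeFactor ν μ z : ℂ) := by
  have h : ContDiff ℝ n fun z : ℂ => -(μ * ‖z‖ / 2) ^ 2 := by
    simp_rw [mul_div_right_comm, mul_pow]
    exact (contDiff_const.mul (contDiff_norm_sq ℝ)).neg
  exact Complex.ofRealCLM.contDiff.comp
    (contDiff_const.mul ((contDiff_besselClifford hν).comp h))

theorem besselModeFactor_zero_ne_zero (hν : -1 < ν) (hμ : 0 < μ) : besselModeFactor ν μ 0 ≠ 0 := by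
  have : 0 < (μ / 2) ^ ν := by positivity
  simpa [besselModeFactor, this.ne'] using besselClifford_zero_ne_zero hν

theorem re_cpow_mul_besselModeFactor (hν : 0 ≤ ν) (hμ : 0 ≤ μ) (z : ℂ) :
    (z ^ (ν : ℂ) * besselModeFactor ν μ z).re = besselJ ν (μ * ‖z‖) * Real.cos (ν * z.arg) := by
  rw [besselModeFactor, Complex.re_mul_ofReal, Complex.cpow_ofReal_re,
    besselJ_eq_rpow_mul_besselClifford hν (by positivity), mul_div_right_comm,
    Real.mul_rpow (by positivity) (norm_nonneg z), mul_comm z.arg]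
  ring

theorem contDiff_besselMode_natCast {m : WithTop ℕ∞} (n : ℕ) (hμ : 0 ≤ μ) :
    ContDiff ℝ m (besselMode n μ) := by
  have h : besselMode n μ = fun x => (toComplex x ^ n * besselModeFactor n μ (toComplex x)).re := by
    funext x
    rw [besselMode, cos_nat_mul_polarAngle, ← toComplex.norm_map x,
      ← re_cpow_mul_besselModeFactor n.cast_nonneg hμ, Complex.ofReal_natCast,
      Complex.cpow_natCast]
  have hn : (-1 : ℝ) < n := by linarith [n.cast_nonneg (α := ℝ)]
  rw [h]
  exact Complex.reCLM.contDiff.comp ((toComplex.contDiff.pow n).mul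
    ((contDiff_ofReal_besselModeFactor hn).comp toComplex.contDiff))

theorem besselMode_eqOn_angularCone (hν : 0 ≤ ν) (hμ : 0 ≤ μ) (δ : ℝ) :
    Set.EqOn (besselMode ν μ)
      (fun x => (toComplex x ^ (ν : ℂ) * besselModeFactor ν μ (toComplex x)).re)
      (angularCone δ) := fun x hx => by
  rw [besselMode, polarAngle_eq_arg hx.2.1.le, ← toComplex.norm_map x]
  exact (re_cpow_mul_besselModeFactor hν hμ _).symm

theorem contDiffOn_besselMode_angularCone {n : WithTop ℕ∞} {δ : ℝ} (hν : 0 ≤ ν) (hμ : 0 ≤ μ) :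
    ContDiffOn ℝ n (besselMode ν μ) (angularCone δ) := by
  refine ContDiffOn.congr (fun x hx => ?_) (besselMode_eqOn_angularCone hν hμ δ)
  have h : ContDiffAt ℝ n (fun z => z ^ (ν : ℂ) * besselModeFactor ν μ z) (toComplex x) :=
    contDiffAt_cpow_mul hx.1 (contDiff_ofReal_besselModeFactor (by linarith)).contDiffAt
  exact (Complex.reCLM.contDiff.contDiffAt.comp x
    (h.comp x toComplex.contDiff.contDiffAt)).contDiffWithinAt

theorem exists_iteratedFDeriv_besselMode_eqOn {δ : ℝ} (hν : 0 ≤ ν) (hμ : 0 ≤ μ) (hδ : 0 < δ)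
    (l : ℕ) : ∃ P : ℂ → ℂ, Continuous P ∧
      P 0 = ((descPochhammer ℝ l).eval ν * besselModeFactor ν μ 0 : ℝ) ∧
      Set.EqOn
        (fun x => iteratedFDeriv ℝ l (besselMode ν μ) x fun _ => EuclideanSpace.single 0 1)
        (fun x => (toComplex x ^ ((ν - l : ℝ) : ℂ) * P (toComplex x)).re) (angularCone δ) := by
  have hν' : -1 < ν := by linarith
  obtain ⟨P, hP, hP0, hPeq⟩ :=
    exists_iteratedFDeriv_cpow_mul_eqOn ν (contDiff_ofReal_besselModeFactor (μ := μ) hν') l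
  refine ⟨P, hP, by rw [hP0, Complex.ofReal_mul, ofReal_eval_descPochhammer], fun x hx => ?_⟩
  have hcd : ContDiffAt ℝ l (fun z => z ^ (ν : ℂ) * besselModeFactor ν μ z) (toComplex x) :=
    contDiffAt_cpow_mul hx.1 (contDiff_ofReal_besselModeFactor hν').contDiffAt
  have hloc := ((besselMode_eqOn_angularCone hν hμ δ).eventuallyEq_of_mem
    ((isOpenCone_angularCone hδ).isOpen.mem_nhds hx)).iteratedFDeriv ℝ l |>.eq_of_nhds
  simp only [hloc, iteratedFDeriv_re_comp_toComplex hcd, toComplex_single_zero_one,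
    Complex.ofReal_sub, Complex.ofReal_natCast]
  exact congrArg Complex.re (hPeq hx.1)

theorem isTheta_iteratedFDeriv_besselMode {δ : ℝ} {l : ℕ} (hν : 0 ≤ ν) (hμ : 0 < μ)
    (hνl : ∀ i < l, ν ≠ i) (hδ : 0 < δ) (hδl : δ * |ν - l| ≤ 1) :
    (fun x => iteratedFDeriv ℝ l (besselMode ν μ) x fun _ => EuclideanSpace.single 0 1)
      =Θ[𝓝[angularCone δ] 0] fun x => ‖x‖ ^ (ν - l) := by
  obtain ⟨P, hP, hP0, hPeq⟩ := exists_iteratedFDeriv_besselMode_eqOn hν hμ.le hδ l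
  have hlim : Filter.Tendsto P (Filter.map toComplex (𝓝[angularCone δ] 0)) (𝓝 (P 0)) :=
    Filter.tendsto_map'_iff.2 (((hP.comp toComplex.continuous).tendsto' 0 (P 0)
      (by simp)).mono_left nhdsWithin_le_nhds)
  have hcoeff : (descPochhammer ℝ l).eval ν * besselModeFactor ν μ 0 ≠ 0 :=
    mul_ne_zero (eval_descPochhammer_ne_zero hνl)
      (besselModeFactor_zero_ne_zero (by linarith) hμ)
  have harg : ∀ᶠ z in Filter.map toComplex (𝓝[angularCone δ] 0), |z.arg * (ν - l)| ≤ 1 := by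
    refine Filter.eventually_map.2 (eventually_mem_nhdsWithin.mono fun x hx => ?_)
    rw [abs_mul, abs_of_pos hx.2.1]
    exact (mul_le_mul_of_nonneg_right hx.2.2.le (abs_nonneg _)).trans hδl
  rw [hP0] at hlim
  have h := isTheta_re_cpow_mul hlim hcoeff harg
  refine (Filter.eventuallyEq_of_mem self_mem_nhdsWithin hPeq).trans_isTheta ?_
  simp_rw [← toComplex.norm_map]
  exact ⟨h.1.comp_tendsto Filter.tendsto_map, h.2.comp_tendsto Filter.tendsto_map⟩

theorem not_memSobolevSlobodeckij_besselMode {ω s : ℝ} (hω : 0 < ω) (hν : 0 ≤ ν)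
    (hνn : ¬ ∃ n : ℕ, ν = n) (hμ : 0 < μ) (hs : ν + 1 ≤ s) :
    ¬ MemSobolevSlobodeckij s (circularSector ω) (besselMode ν μ) := by
  set a := ν - ⌊s⌋₊
  have ha : a < 0 := by linarith [Nat.lt_floor_add_one s]
  set δ := min ω (1 / |a|)
  have ha' : 0 < |a| := abs_pos.2 ha.ne
  have hδ : 0 < δ := lt_min hω (by positivity)
  have hδa : δ * |a| ≤ 1 := (le_div_iff₀ ha').1 (min_le_right _ _)
  have hK := isOpenCone_angularCone hδ
  refine not_memSobolevSlobodeckij_of_isTheta hK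
    (circularSector_mem_nhdsWithin_angularCone (min_le_left _ _))
    (eventually_mem_nhdsWithin.mono fun x hx =>
      (contDiffOn_besselMode_angularCone hν hμ.le).contDiffAt (hK.isOpen.mem_nhds hx))
    (fun _ => 0)
    (isTheta_iteratedFDeriv_besselMode hν hμ (fun i _ h => hνn ⟨i, h⟩) hδ hδa) ha
    (by linarith) ?_
  push_cast
  linarith

end BesselModes

theorem lemma2_general {ω ν μ : ℝ} (hω : 0 < ω) (hν : 0 ≤ ν) (hμ : 0 < μ) :
    ((∀ s : ℝ, 0 ≤ s → MemSobolevSlobodeckij s (circularSector ω) (besselMode ν μ)) ↔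
      ∃ n : ℕ, ν = n) ∧
    ((¬ ∃ n : ℕ, ν = n) →
      ∀ s : ℝ, ν + 1 ≤ s → ¬ MemSobolevSlobodeckij s (circularSector ω) (besselMode ν μ)) := by
  refine ⟨⟨fun h => ?_, ?_⟩, fun hn s => not_memSobolevSlobodeckij_besselMode hω hν hn hμ⟩
  · by_contra hn
    exact not_memSobolevSlobodeckij_besselMode hω hν hn hμ le_rfl (h (ν + 1) (by linarith))
  · rintro ⟨n, rfl⟩ s -
    exact memSobolevSlobodeckij_of_contDiff (Metric.isBounded_ball.subset
      (circularSector_subset_ball ω)) (contDiff_besselMode_natCast n hμ.le)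

theorem lemma2 (ω : ℝ) (hω0 : 0 < ω) (hω1 : ω ≤ 2 * Real.pi) (k m : ℕ) (hm : 1 ≤ m) :
    ((∀ s : ℝ, 0 ≤ s →
        MemSobolevSlobodeckij s (circularSector ω) (sectorEigenfunction ω k m)) ↔
      ∃ n : ℕ, angularFreq ω k = (n : ℝ)) ∧
    ((¬ ∃ n : ℕ, angularFreq ω k = (n : ℝ)) →
      ∀ s : ℝ, angularFreq ω k + 1 ≤ s →
        ¬ MemSobolevSlobodeckij s (circularSector ω) (sectorEigenfunction ω k m)) :=
  lemma2_general hω0 (mul_nonneg k.cast_nonneg (div_pos Real.pi_pos hω0).le)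
    (besselZero_pos (angularFreq ω k) m)
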